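/- Let $\mathbb F$ be a field with $\operatorname{char}\mathbb F\neq 2$. Let $L$ be a Lie algebra over $\mathbb F$ (of arbitrary dimension) that is perfect, i.e. $[L,L]=L$, and zero product determined (zpd), i.e. for every bilinear map $f:L\times L\to\mathbb F$ such that $[x,y]=0$ implies $f(x,y)=0$ for all $x,y\in L$, there is a linear map $\Phi:[L,L]\to\mathbb F$ with $f(x,y)=\Phi([x,y])$ for all $x,y\in L$. Let $A$ be a unital associative algebra over $\mathbb F$ whose center $Z$ is a field. Let $\varphi:L\to A$ be a linear map that preserves commutativity, i.e. $[x,y]=0$ implies $\varphi(x)\varphi(y)=\varphi(y)\varphi(x)$, and suppose that the range of $\varphi$ is a $3$-free subset of $A$. Then there exist an element $\alpha\in Z$, a Lie algebra homomorphism $\theta:L\to A$ (where $A$ carries the commutator bracket $[a,b]=ab-ba$), and a linear map $\beta:L\to Z$ such that $$\varphi(x)=\alpha\,\theta(x)+\beta(x)\qquad\text{for all }x\in L.$$ Here a nonempty subset $R\subseteq A$ is called $d$-free if for all $m\ge 1$, all $I,J\subseteq\{1,\dots,m\}$ and all (arbitrary) functions $E_i,F_j:R^{m-1}\to A$ ($i\in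 I$, $j\in J$) conditions (a) and (b) below hold. For $\bar x=(x_1,\dots,x_m)\in R^m$ let $\bar x^{i}$, respectively $\bar x^{ij}$, denote the tuple with $x_i$, respectively $x_i$ and $x_j$, omitted, and put $$H(\bar x)=\sum_{i\in I}E_i(\bar x^{i})x_i+\sum_{j\in J}x_jF_j(\bar x^{j}).$$ (a) If $\max\{|I|,|J|\}\le d$ and $H(\bar x)=0$ for all $\bar x\in R^m$, then there are functions $p_{ij}:R^{m-2}\to A$ ($i\in I$, $j\in J$, $i\ne j$) and $\lambda_k:R^{m-1}\to Z$ ($k\in I\cup J$), with $\lambda_k=0$ whenever $k\notin I\cap J$, such that for all $\bar x\in R^m$ $$E_i(\bar x^{i})=\sum_{j\in J,\,j\ne i}x_j\,p_{ij}(\bar x^{ij})+\lambda_i(\bar x^{i})\ \ (i\in I),\qquad F_j(\bar x^{j})=-\sum_{i\in I,\,i\ne j}p_{ij}(\bar x^{ij})\,x_i-\lambda_j(\bar x^{j})\ \ (j\in J).$$ (b) If $\max\{|I|,|J|\}\le d-1$ and $H(\bar x)\in Z$ for all $\bar x\in R^m$, then the same conclusion holds. -/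

import Mathlib

/- A unital associative algebra is a Lie algebra under the commutator `⁅a, b⁆ = a * b - b * a`. -/
attribute [local instance 100] LieRing.ofAssociativeRing

/-- The bracket `⁅x, y⁆` as an element of the derived algebra `[L, L]`. -/
def bracketInDerived (F : Type*) {L : Type*} [Field F] [LieRing L] [LieAlgebra F L] (x y : L) :
    (⁅(⊤ : LieIdeal F L), (⊤ : LieIdeal F L)⁆ : LieIdeal F L) :=
  ⟨⁅x, y⁆, LieSubmodule.lie_mem_lie (LieSubmodule.mem_top x) (LieSubmodule.mem_top y)⟩

/-- `L` is zero product determined (zpd): every bilinear form `f` on `L` that vanishes on commuting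
pairs is of the form `f (x, y) = Φ [x, y]` for a linear functional `Φ` on `[L, L]`. -/
def IsZpdLie (F L : Type*) [Field F] [LieRing L] [LieAlgebra F L] : Prop :=
  ∀ f : L →ₗ[F] L →ₗ[F] F, (∀ x y : L, ⁅x, y⁆ = 0 → f x y = 0) →
    ∃ Φ : (⁅(⊤ : LieIdeal F L), (⊤ : LieIdeal F L)⁆ : LieIdeal F L) →ₗ[F] F,
      ∀ x y : L, f x y = Φ (bracketInDerived F x y)

/-- `L` is perfect: `[L, L] = L`. -/
def IsPerfectLie (F L : Type*) [Field F] [LieRing L] [LieAlgebra F L] : Prop :=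
  (⁅(⊤ : LieIdeal F L), (⊤ : LieIdeal F L)⁆ : LieIdeal F L) = ⊤

/-- A linear map from a Lie algebra to an associative algebra preserves commutativity:
if `[x, y] = 0` then `φ x` and `φ y` commute. -/
def PreservesCommutativity {F L A : Type*} [Field F] [LieRing L] [LieAlgebra F L]
    [Ring A] [Algebra F A] (φ : L →ₗ[F] A) : Prop :=
  ∀ x y : L, ⁅x, y⁆ = 0 → Commute (φ x) (φ y)

namespace FunctionalIdentity

variable {A : Type*}

/-- The tuple `x` with its `i`-th entry omitted. -/
def omit₁ {R : Set A} {m : ℕ} (x : Fin m → R) (i : Fin m) : {k : Fin m // k ≠ i} → R :=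
  fun k => x k

/-- The tuple `x` with its `i`-th and `j`-th entries omitted. -/
def omit₂ {R : Set A} {m : ℕ} (x : Fin m → R) (i j : Fin m) :
    {k : Fin m // k ≠ i ∧ k ≠ j} → R :=
  fun k => x k

variable [Ring A]

/-- The value `∑_{i ∈ I} E_i(x₁, …, x̂_i, …, x_m) x_i + ∑_{j ∈ J} x_j F_j(x₁, …, x̂_j, …, x_m)`. -/
def value {R : Set A} {m : ℕ} (I J : Finset (Fin m))
    (E F : (i : Fin m) → ({k : Fin m // k ≠ i} → R) → A) (x : Fin m → R) : A :=
  ∑ i ∈ I, E i (omit₁ x i) * (x i : A) + ∑ j ∈ J, (x j : A) * F j (omit₁ x j)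

/-- `(E_i)_{i ∈ I}`, `(F_j)_{j ∈ J}` form a standard solution: there are functions `p_{ij}` of the
variables other than `x_i, x_j` and central-valued functions `c_k` of the variables other than
`x_k`, with `c_k = 0` for `k ∉ I ∩ J`, such that
`E_i = ∑_{j ∈ J, j ≠ i} x_j p_{ij} + c_i` and `F_j = - ∑_{i ∈ I, i ≠ j} p_{ij} x_i - c_j`. -/
def IsStandardSolution {R : Set A} {m : ℕ} (I J : Finset (Fin m))
    (E F : (i : Fin m) → ({k : Fin m // k ≠ i} → R) → A) : Prop :=
  ∃ (p : (i j : Fin m) → ({k : Fin m // k ≠ i ∧ k ≠ j} → R) → A)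
    (c : (k : Fin m) → ({l : Fin m // l ≠ k} → R) → A),
    (∀ k y, c k y ∈ Subring.center A) ∧
    (∀ k, k ∉ I ∩ J → ∀ y, c k y = 0) ∧
    (∀ i ∈ I, ∀ x : Fin m → R,
      E i (omit₁ x i) = ∑ j ∈ J.erase i, (x j : A) * p i j (omit₂ x i j) + c i (omit₁ x i)) ∧
    (∀ j ∈ J, ∀ x : Fin m → R,
      F j (omit₁ x j) =
        -(∑ i ∈ I.erase j, p i j (omit₂ x i j) * (x i : A)) - c j (omit₁ x j))

/-- `R` is a `d`-free subset of the unital ring `A`: for every `m` and all `I, J ⊆ {1, …, m}`,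
(a) if `max (|I|, |J|) ≤ d`, the basic functional identity with value `0` has only standard
solutions; (b) if `max (|I|, |J|) ≤ d - 1`, the basic functional identity with values in the
center has only standard solutions. The functions `E_i`, `F_j` are arbitrary. -/
def IsDFree (d : ℕ) (R : Set A) : Prop :=
  R.Nonempty ∧
  ∀ (m : ℕ) (I J : Finset (Fin m)) (E F : (i : Fin m) → ({k : Fin m // k ≠ i} → R) → A),
    (max I.card J.card ≤ d → (∀ x : Fin m → R, value I J E F x = 0) →
      IsStandardSolution I J E F) ∧
    (max I.card J.card < d → (∀ x : Fin m → R, value I J E F x ∈ Subring.center A) →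
      IsStandardSolution I J E F)

end FunctionalIdentity

/-! Write `[a, b]` for the commutator in `A`. The zpd property, extended to vector-valued forms
(`IsZpdLie.exists_linearMap`), turns preservation of commutativity into `[φ x, φ y] = Ψ ⁅x, y⁆` with
`Ψ` linear. The Jacobi identity in `L` then makes the cyclic sum of `[φ ⁅x, y⁆, φ z]` vanish
(`commutator_jacobi`). This is a functional identity in three variables on the range of `φ`, and
3-freeness forces `φ ⁅x, y⁆ ≡ z [φ x, φ y]` modulo the center for a fixed central `z`
(`exists_sub_mul_commutator_mem_center`, `exists_map_lie_sub_mem_center`).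

Hence `φ - zΨ` is central on brackets, and by perfectness everywhere. If `z = 0`, `φ` itself is
central-valued. Otherwise `z` is invertible in the center, `z²Ψ` is a Lie homomorphism, and `φ =
z⁻¹(z²Ψ) + (φ - zΨ)`. -/

open Function in
/-- The defining property of a `d`-free set, for functions of the full tuple of variables that do
not depend on the omitted ones. -/
theorem FunctionalIdentity.IsDFree.exists_standard {A : Type*} [Ring A] {R : Set A} {d m : ℕ}
    (hR : FunctionalIdentity.IsDFree d R) (I J : Finset (Fin m))
    (e f : Fin m → (Fin m → R) → A)
    (he : ∀ i x r, e i (update x i r) = e i x) (hf : ∀ j x r, f j (update x j r) = f j x)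
    (h : (max I.card J.card ≤ d ∧
        ∀ x, ∑ i ∈ I, e i x * (x i : A) + ∑ j ∈ J, (x j : A) * f j x = 0) ∨
      (max I.card J.card < d ∧
        ∀ x, ∑ i ∈ I, e i x * (x i : A) + ∑ j ∈ J, (x j : A) * f j x ∈ Subring.center A)) :
    ∃ (p : Fin m → Fin m → (Fin m → R) → A) (c : Fin m → (Fin m → R) → A),
      (∀ i j x r, p i j (update x i r) = p i j x) ∧
      (∀ i j x r, p i j (update x j r) = p i j x) ∧
      (∀ k x r, c k (update x k r) = c k x) ∧
      (∀ k x, c k x ∈ Subring.center A) ∧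
      (∀ k, k ∉ I ∩ J → ∀ x, c k x = 0) ∧
      (∀ i ∈ I, ∀ x, e i x = ∑ j ∈ J.erase i, (x j : A) * p i j x + c i x) ∧
      (∀ j ∈ J, ∀ x, f j x = -(∑ i ∈ I.erase j, p i j x * (x i : A)) - c j x) := by
  classical
  obtain ⟨⟨r₀, hr₀⟩, hR⟩ := hR
  -- The omitted slot is filled with a fixed element of `R`; by `he` and `hf` the choice does not
  -- matter.
  let ext : (i : Fin m) → ({k : Fin m // k ≠ i} → R) → Fin m → R :=
    fun i y k => if hk : k ≠ i then y ⟨k, hk⟩ else ⟨r₀, hr₀⟩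
  have hext : ∀ i (x : Fin m → R), ext i (omit₁ x i) = update x i ⟨r₀, hr₀⟩ := by
    intro i x
    funext k
    by_cases hk : k = i
    · subst hk; simp [ext]
    · simp [ext, hk, omit₁]
  have hval : ∀ x, value I J (fun i y => e i (ext i y)) (fun j y => f j (ext j y)) x =
      ∑ i ∈ I, e i x * (x i : A) + ∑ j ∈ J, (x j : A) * f j x := by
    intro x
    simp only [value, hext, he, hf]
  have hstd : IsStandardSolution I J (fun i y => e i (ext i y)) (fun j y => f j (ext j y)) := by
    rcases h with ⟨hc, h⟩ | ⟨hc, h⟩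
    · exact (hR m I J _ _).1 hc fun x => by rw [hval, h]
    · exact (hR m I J _ _).2 hc fun x => by rw [hval]; exact h x
  obtain ⟨p, c, hcZ, hc0, hE, hF⟩ := hstd
  refine ⟨fun i j x => p i j (omit₂ x i j), fun k x => c k (omit₁ x k), ?_, ?_, ?_,
    fun k x => hcZ _ _, fun k hk x => hc0 k hk _, ?_, ?_⟩
  · intro i j x r
    have : omit₂ (update x i r) i j = omit₂ x i j := funext fun k => by simp [omit₂, k.2.1]
    simp only [this]
  · intro i j x r
    have : omit₂ (update x j r) i j = omit₂ x i j := funext fun k => by simp [omit₂, k.2.2]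
    simp only [this]
  · intro k x r
    have : omit₁ (update x k r) k = omit₁ x k := funext fun l => by simp [omit₁, l.2]
    simp only [this]
  · intro i hi x
    have := hE i hi x
    simpa only [hext, he] using this
  · intro j hj x
    have := hF j hj x
    simpa only [hext, hf] using this

/-! ### Functional identities in one, two and three variables -/

namespace FunctionalIdentity.IsDFree

open Function

variable {A : Type*} [Ring A] {R : Set A}

/-- With a single variable there are no `p i j`, so a standard solution consists of the central term
alone. -/
theorem one_variable {d : ℕ} (hR : IsDFree d R) (hd : 1 < d) {a b : A}
    (h : ∀ r : R, a * r + r * b ∈ Subring.center A) : a ∈ Subring.center A ∧ b = -a := by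
  obtain ⟨p, c, -, -, -, hcZ, -, hE, hF⟩ := hR.exists_standard (m := 1) {0} {0}
    (fun _ _ => a) (fun _ _ => b) (by simp) (by simp)
    (Or.inr ⟨by simpa using hd, fun x => by simpa using h (x 0)⟩)
  obtain ⟨r₀, hr₀⟩ := hR.1
  have h1 := hE 0 (by simp) (fun _ => ⟨r₀, hr₀⟩)
  have h2 := hF 0 (by simp) (fun _ => ⟨r₀, hr₀⟩)
  simp at h1 h2
  rw [h1]
  exact ⟨hcZ _ _, h2⟩

theorem eq_zero_of_mul_mem_center {d : ℕ} (hR : IsDFree d R) (hd : 1 < d) {a : A}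
    (h : ∀ r : R, a * r ∈ Subring.center A) : a = 0 := by
  have := hR.one_variable hd (a := a) (b := 0) (by simpa using h)
  simpa using this.2.symm

theorem mem_center_of_commute {d : ℕ} (hR : IsDFree d R) (hd : 1 < d) {a : A}
    (h : ∀ r : R, a * r - r * a ∈ Subring.center A) : a ∈ Subring.center A :=
  (hR.one_variable hd (a := a) (b := -a) fun r => by
    simpa [sub_eq_add_neg] using h r).1

theorem two_variables {d : ℕ} (hR : IsDFree d R) (hd : 2 ≤ d) (e₀ e₁ f₀ f₁ : R → A)
    (h : ∀ r s : R, e₀ s * r + e₁ r * s + (r * f₀ s + s * f₁ r) = 0) :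
    ∃ (p q : A) (c₀ c₁ : R → A), (∀ r, c₀ r ∈ Subring.center A) ∧ (∀ r, c₁ r ∈ Subring.center A) ∧
      (∀ r, e₀ r = r * p + c₀ r) ∧ (∀ r, e₁ r = r * q + c₁ r) ∧
      (∀ r, f₀ r = -(q * r) - c₀ r) ∧ (∀ r, f₁ r = -(p * r) - c₁ r) := by
  obtain ⟨p, c, hp1, hp2, hc, hcZ, -, hE, hF⟩ := hR.exists_standard (m := 2) {0, 1} {0, 1}
    ![fun x => e₀ (x 1), fun x => e₁ (x 0)] ![fun x => f₀ (x 1), fun x => f₁ (x 0)]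
    (by simp [Fin.forall_fin_two]) (by simp [Fin.forall_fin_two])
    (Or.inl ⟨by simpa using hd, fun x => by simpa using h (x 0) (x 1)⟩)
  obtain ⟨r₀, hr₀⟩ := hR.1
  let o : R := ⟨r₀, hr₀⟩
  have u0 : ∀ r s t : R, update ![r, s] 0 t = ![t, s] := by
    intro r s t; funext k; fin_cases k <;> rfl
  have u1 : ∀ r s t : R, update ![r, s] 1 t = ![r, t] := by
    intro r s t; funext k; fin_cases k <;> rfl
  -- For `m = 2` each `p i j` omits both variables, so it is a constant.
  have hp01 : ∀ r s : R, p 0 1 ![r, s] = p 0 1 ![o, o] := fun r s => by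
    have h1 := hp1 0 1 ![r, s] o
    have h2 := hp2 0 1 ![o, s] o
    rw [u0] at h1; rw [u1] at h2
    rw [h2, h1]
  have hp10 : ∀ r s : R, p 1 0 ![r, s] = p 1 0 ![o, o] := fun r s => by
    have h1 := hp2 1 0 ![r, s] o
    have h2 := hp1 1 0 ![o, s] o
    rw [u0] at h1; rw [u1] at h2
    rw [h2, h1]
  have e01 : ({0, 1} : Finset (Fin 2)).erase 0 = {1} := by decide
  have e10 : ({0, 1} : Finset (Fin 2)).erase 1 = {0} := by decide
  refine ⟨p 0 1 ![o, o], p 1 0 ![o, o], fun r => c 0 ![o, r], fun r => c 1 ![r, o],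
    fun r => hcZ _ _, fun r => hcZ _ _, fun r => ?_, fun r => ?_, fun r => ?_, fun r => ?_⟩
  · simpa [e01, hp01] using hE 0 (by simp) ![o, r]
  · simpa [e10, hp10] using hE 1 (by simp) ![r, o]
  · simpa [e01, hp10] using hF 0 (by simp) ![o, r]
  · simpa [e10, hp01] using hF 1 (by simp) ![r, o]

/-- When `J` is empty there are no `p i j` and every central term vanishes, so the only standard
solution is zero. -/
theorem two_variables_left {d : ℕ} (hR : IsDFree d R) (hd : 2 < d) (e₀ e₁ : R → A)
    (h : ∀ r s : R, e₀ s * r + e₁ r * s ∈ Subring.center A) : e₀ = 0 ∧ e₁ = 0 := by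
  obtain ⟨p, c, -, -, -, -, hc0, hE, -⟩ := hR.exists_standard (m := 2) {0, 1} ∅
    ![fun x => e₀ (x 1), fun x => e₁ (x 0)] 0
    (by simp [Fin.forall_fin_two]) (by simp)
    (Or.inr ⟨by simpa using hd, fun x => by simpa using h (x 0) (x 1)⟩)
  constructor <;> funext r
  · simpa [hc0] using hE 0 (by simp) ![r, r]
  · simpa [hc0] using hE 1 (by simp) ![r, r]

theorem two_variables_right {d : ℕ} (hR : IsDFree d R) (hd : 2 < d) (f₀ f₁ : R → A)
    (h : ∀ r s : R, r * f₀ s + s * f₁ r ∈ Subring.center A) : f₀ = 0 ∧ f₁ = 0 := by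
  obtain ⟨p, c, -, -, -, -, hc0, -, hF⟩ := hR.exists_standard (m := 2) ∅ {0, 1}
    0 ![fun x => f₀ (x 1), fun x => f₁ (x 0)]
    (by simp) (by simp [Fin.forall_fin_two])
    (Or.inr ⟨by simpa using hd, fun x => by simpa using h (x 0) (x 1)⟩)
  constructor <;> funext r
  · simpa [hc0] using hF 0 (by simp) ![r, r]
  · simpa [hc0] using hF 1 (by simp) ![r, r]

theorem three_variables_left {d : ℕ} (hR : IsDFree d R) (hd : 3 ≤ d) (e₀ e₁ e₂ : R → R → A)
    (h : ∀ r s t : R, e₀ s t * r + e₁ t r * s + e₂ r s * t = 0) : e₂ = 0 := by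
  obtain ⟨p, c, -, -, -, -, hc0, hE, -⟩ := hR.exists_standard (m := 3) Finset.univ ∅
    ![fun x => e₀ (x 1) (x 2), fun x => e₁ (x 2) (x 0), fun x => e₂ (x 0) (x 1)] 0
    (by simp [Fin.forall_fin_succ]) (by simp)
    (Or.inl ⟨by simpa using hd, fun x => by
      simpa [Fin.sum_univ_three] using h (x 0) (x 1) (x 2)⟩)
  funext r s
  simpa [hc0] using hE 2 (by simp) ![r, s, r]

/-- The solutions of `∑ [G (r, s), t] = 0`, the sum being over the cyclic permutations of
`r, s, t`. -/
theorem three_variables_cyclic {d : ℕ} (hR : IsDFree d R) (hd : 3 ≤ d) (G : R → R → A)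
    (h : ∀ r s t : R, (G s t * r - r * G s t) + (G t r * s - s * G t r) +
      (G r s * t - t * G r s) = 0) :
    ∃ (p₀₁ p₀₂ p₁₀ p₁₂ p₂₀ p₂₁ : R → A) (c₀ c₁ c₂ : R → R → A),
      (∀ r s, c₀ r s ∈ Subring.center A) ∧ (∀ r s, c₁ r s ∈ Subring.center A) ∧
      (∀ r s, c₂ r s ∈ Subring.center A) ∧
      (∀ s t, G s t = s * p₀₁ t + t * p₀₂ s + c₀ s t) ∧
      (∀ t r, G t r = r * p₁₀ t + t * p₁₂ r + c₁ t r) ∧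
      (∀ r s, G r s = r * p₂₀ s + s * p₂₁ r + c₂ r s) ∧
      (∀ r s, G r s = p₀₂ s * r + p₁₂ r * s + c₂ r s) := by
  obtain ⟨p, c, hp1, hp2, hc, hcZ, -, hE, hF⟩ :=
    hR.exists_standard (m := 3) Finset.univ Finset.univ
    ![fun x => G (x 1) (x 2), fun x => G (x 2) (x 0), fun x => G (x 0) (x 1)]
    ![fun x => -G (x 1) (x 2), fun x => -G (x 2) (x 0), fun x => -G (x 0) (x 1)]
    (by simp [Fin.forall_fin_succ]) (by simp [Fin.forall_fin_succ])
    (Or.inl ⟨by simpa using hd, fun x => by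
      rw [← h (x 0) (x 1) (x 2)]
      simp [Fin.sum_univ_three]
      abel⟩)
  obtain ⟨r₀, hr₀⟩ := hR.1
  let o : R := ⟨r₀, hr₀⟩
  have u0 : ∀ r s t w : R, update ![r, s, t] 0 w = ![w, s, t] := by
    intro r s t w; funext k; fin_cases k <;> rfl
  have u1 : ∀ r s t w : R, update ![r, s, t] 1 w = ![r, w, t] := by
    intro r s t w; funext k; fin_cases k <;> rfl
  have u2 : ∀ r s t w : R, update ![r, s, t] 2 w = ![r, s, w] := by
    intro r s t w; funext k; fin_cases k <;> rfl
  -- For `m = 3` each `p i j` depends only on the one remaining variable; the other two are frozen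
  -- at `o`.
  have hp01 : ∀ r s t : R, p 0 1 ![r, s, t] = p 0 1 ![o, o, t] := fun r s t => by
    have h1 := hp1 0 1 ![r, s, t] o
    have h2 := hp2 0 1 ![o, s, t] o
    rw [u0] at h1; rw [u1] at h2
    rw [h2, h1]
  have hp10 : ∀ r s t : R, p 1 0 ![r, s, t] = p 1 0 ![o, o, t] := fun r s t => by
    have h1 := hp2 1 0 ![r, s, t] o
    have h2 := hp1 1 0 ![o, s, t] o
    rw [u0] at h1; rw [u1] at h2
    rw [h2, h1]
  have hp02 : ∀ r s t : R, p 0 2 ![r, s, t] = p 0 2 ![o, s, o] := fun r s t => by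
    have h1 := hp1 0 2 ![r, s, t] o
    have h2 := hp2 0 2 ![o, s, t] o
    rw [u0] at h1; rw [u2] at h2
    rw [h2, h1]
  have hp20 : ∀ r s t : R, p 2 0 ![r, s, t] = p 2 0 ![o, s, o] := fun r s t => by
    have h1 := hp2 2 0 ![r, s, t] o
    have h2 := hp1 2 0 ![o, s, t] o
    rw [u0] at h1; rw [u2] at h2
    rw [h2, h1]
  have hp12 : ∀ r s t : R, p 1 2 ![r, s, t] = p 1 2 ![r, o, o] := fun r s t => by
    have h1 := hp1 1 2 ![r, s, t] o
    have h2 := hp2 1 2 ![r, o, t] o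
    rw [u1] at h1; rw [u2] at h2
    rw [h2, h1]
  have hp21 : ∀ r s t : R, p 2 1 ![r, s, t] = p 2 1 ![r, o, o] := fun r s t => by
    have h1 := hp2 2 1 ![r, s, t] o
    have h2 := hp1 2 1 ![r, o, t] o
    rw [u1] at h1; rw [u2] at h2
    rw [h2, h1]
  have e0 : (Finset.univ : Finset (Fin 3)).erase 0 = {1, 2} := by decide
  have e1 : (Finset.univ : Finset (Fin 3)).erase 1 = {0, 2} := by decide
  have e2 : (Finset.univ : Finset (Fin 3)).erase 2 = {0, 1} := by decide
  refine ⟨fun t => p 0 1 ![o, o, t], fun s => p 0 2 ![o, s, o], fun t => p 1 0 ![o, o, t],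
    fun r => p 1 2 ![r, o, o], fun s => p 2 0 ![o, s, o], fun r => p 2 1 ![r, o, o],
    fun s t => c 0 ![o, s, t], fun t r => c 1 ![r, o, t], fun r s => c 2 ![r, s, o],
    fun _ _ => hcZ _ _, fun _ _ => hcZ _ _, fun _ _ => hcZ _ _,
    fun s t => ?_, fun t r => ?_, fun r s => ?_, fun r s => ?_⟩
  · have := hE 0 (by simp) ![o, s, t]
    rw [e0, Finset.sum_pair (by decide), hp01, hp02] at this
    exact this
  · have := hE 1 (by simp) ![r, o, t]
    rw [e1, Finset.sum_pair (by decide), hp10, hp12] at this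
    exact this
  · have := hE 2 (by simp) ![r, s, o]
    rw [e2, Finset.sum_pair (by decide), hp20, hp21] at this
    exact this
  · have := hF 2 (by simp) ![r, s, o]
    rw [e2, Finset.sum_pair (by decide), hp02, hp12] at this
    have h' : -G r s = -(p 0 2 ![o, s, o] * r + p 1 2 ![r, o, o] * s) - c 2 ![r, s, o] := this
    rw [← neg_neg (G r s), h']
    abel

/-- An alternating map `G` with `∑ [G (r, s), t] = 0` is, up to central values, a central multiple
of the commutator. -/
theorem exists_sub_mul_commutator_mem_center {d : ℕ} (hR : IsDFree d R) (hd : 3 ≤ d)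
    (h2 : ∀ a : A, a + a = 0 → a = 0) (G : R → R → A) (hG : ∀ r s, G r s = -G s r)
    (h : ∀ r s t : R, (G s t * r - r * G s t) + (G t r * s - s * G t r) +
      (G r s * t - t * G r s) = 0) :
    ∃ z ∈ Subring.center A, ∀ r s : R, G r s - z * (r * s - s * r) ∈ Subring.center A := by
  obtain ⟨p₀₁, p₀₂, p₁₀, p₁₂, p₂₀, p₂₁, c₀, c₁, c₂, hc₀, hc₁, hc₂, H0, H1, H2, H2'⟩ :=
    hR.three_variables_cyclic hd G h
  -- Equating the left and right expressions for `G r s` gives a two-variable identity, which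
  -- determines the `p`'s up to constants `a`, `b` and central functions `u`, `v`.
  obtain ⟨a, b, u, v, hu, hv, hA0, hA1, hB0, hB1⟩ := hR.two_variables (by omega)
    (fun s => -p₀₂ s) (fun r => -p₁₂ r) p₂₀ p₂₁ (fun r s => by
      have := (H2 r s).symm.trans (H2' r s)
      have := add_right_cancel this
      linear_combination (norm := noncomm_ring) this)
  have hG1 : ∀ r s : R, G r s = -(r * b * s) - s * a * r - u s * r - v r * s + c₂ r s := by
    intro r s
    have h1 := (Subring.mem_center_iff.1 (hu s)) r
    have h2 := (Subring.mem_center_iff.1 (hv r)) s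
    rw [H2, hB0, hB1, mul_sub, mul_sub, h1, h2]
    noncomm_ring
  -- Comparison with the expression `H0`, which comes from another slot of the cyclic identity,
  -- gives `p₀₂ s = -(a * s) - v s`, while `hA0` gives `p₀₂ s = -(s * a) - u s`; so `[a, s]` is
  -- central.
  have ha : a ∈ Subring.center A := by
    have := (hR.two_variables_right (by omega) (fun t => p₀₁ t + b * t + u t)
      (fun s => p₀₂ s + a * s + v s) (fun s t => by
        have e := (H0 s t).symm.trans (hG1 s t)
        have h1 := (Subring.mem_center_iff.1 (hu t)) s
        have h2 := (Subring.mem_center_iff.1 (hv s)) t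
        have : s * (p₀₁ t + b * t + u t) + t * (p₀₂ s + a * s + v s) = c₂ s t - c₀ s t := by
          simp only [mul_add, h1, h2, ← mul_assoc]
          linear_combination (norm := noncomm_ring) e
        simp only [this]
        exact sub_mem (hc₂ _ _) (hc₀ _ _))).2
    refine hR.mem_center_of_commute (by omega) fun r => ?_
    have e := congrFun this r
    have e' := hA0 r
    simp only [Pi.zero_apply] at e
    have : a * (r : A) - r * a = u r - v r := by
      linear_combination (norm := noncomm_ring) e + e'
    rw [this]
    exact sub_mem (hu _) (hv _)
  -- Antisymmetry of `G` is again a two-variable identity; it yields `b = -a` and `v = -u`.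
  have hab := (hR.two_variables_right (by omega) (fun s => (a + b) * s + (u s + v s))
      (fun s => (a + b) * s + (u s + v s)) (fun r s => by
        have e := hG r s
        rw [hG1 r s, hG1 s r] at e
        have h1 := (Subring.mem_center_iff.1 (hu s)) r
        have h2 := (Subring.mem_center_iff.1 (hv s)) r
        have h3 := (Subring.mem_center_iff.1 (hu r)) s
        have h4 := (Subring.mem_center_iff.1 (hv r)) s
        have : r * ((a + b) * s + (u s + v s)) + s * ((a + b) * r + (u r + v r)) =
            c₂ r s + c₂ s r := by
          simp only [mul_add, add_mul, h1, h2, h3, h4, ← mul_assoc]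
          linear_combination (norm := noncomm_ring) -e
        simp only [this]
        exact add_mem (hc₂ _ _) (hc₂ _ _))).1
  have hab0 : a + b = 0 := hR.eq_zero_of_mul_mem_center (by omega) fun r => by
    have e := congrFun hab r
    simp only [Pi.zero_apply] at e
    rw [eq_neg_of_add_eq_zero_left e]
    exact neg_mem (add_mem (hu _) (hv _))
  have hb : b = -a := eq_neg_of_add_eq_zero_right hab0
  have huv : ∀ r, v r = -u r := fun r => by
    have e := congrFun hab r
    simp only [hab0, Pi.zero_apply, zero_mul, zero_add] at e
    exact eq_neg_of_add_eq_zero_right e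
  have hG2 : ∀ r s : R, G r s = a * (r * s - s * r) + (u r * s - u s * r) + c₂ r s := by
    intro r s
    rw [hG1, hb, huv]
    have h1 := (Subring.mem_center_iff.1 ha) r
    have h2 := (Subring.mem_center_iff.1 ha) s
    simp only [mul_neg, neg_mul, h1, h2]
    noncomm_ring
  have hu0 : u = 0 := by
    have h3 : (fun r s : R => u r * (s : A) - u s * r) = 0 :=
      hR.three_variables_left hd (fun r s => u r * s - u s * r) (fun r s => u r * s - u s * r) (fun r s => u r * s - u s * r)
        (fun r s t => by
          -- Substituting `hG2` in the cyclic identity, the `a` terms cancel by Jacobi and the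
          -- central terms drop out. What remains is exactly twice the cyclic sum of `(u r * s - u s
          -- * r) * t`, so characteristic not 2 enters here.
          refine h2 _ ?_
          rw [← h r s t, hG2, hG2, hG2]
          have a1 := (Subring.mem_center_iff.1 ha)
          have u1 := fun r => (Subring.mem_center_iff.1 (hu r))
          have c1 := fun r s => (Subring.mem_center_iff.1 (hc₂ r s))
          have e1 : ∀ r s t : R, (a * (r * s - s * r) + (u r * s - u s * r) + c₂ r s) * t -
              t * (a * (r * s - s * r) + (u r * s - u s * r) + c₂ r s) =
              a * ((r * s - s * r) * t - t * (r * s - s * r)) +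
              (u r * (s * t - t * s) - u s * (r * t - t * r)) := by
            intro r s t
            have k1 := a1 t
            have k2 := u1 r t
            have k3 := u1 s t
            have k4 := c1 r s t
            simp only [mul_add, mul_sub, add_mul, sub_mul, ← mul_assoc, k1, k2, k3, k4]
            abel
          rw [e1, e1, e1]
          noncomm_ring)
    have h4 := (hR.two_variables_left (by omega) (fun s => -u s) u (fun r s => by
      have := congrFun (congrFun h3 r) s
      simp only [Pi.zero_apply] at this
      have e : -u s * r + u r * s = 0 := by rw [← this]; noncomm_ring
      simp only [e]
      exact zero_mem _)).2
    exact h4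
  refine ⟨a, ha, fun r s => ?_⟩
  rw [hG2, hu0]
  simpa using hc₂ r s

end FunctionalIdentity.IsDFree

/-! ### Perfect zero product determined Lie algebras -/

theorem IsPerfectLie.span_bracket_eq_top {F L : Type*} [Field F] [LieRing L] [LieAlgebra F L]
    (hL : IsPerfectLie F L) : Submodule.span F {z : L | ∃ x y : L, ⁅x, y⁆ = z} = ⊤ := by
  have h := LieSubmodule.lieIdeal_oper_eq_linear_span' (R := F) (⊤ : LieIdeal F L)
    (⊤ : LieIdeal F L)
  rw [hL] at h
  simpa using h.symm

open scoped TensorProduct in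
/-- In a perfect zpd Lie algebra, the zpd property holds for bilinear maps into any vector space. -/
theorem IsZpdLie.exists_linearMap {F L V : Type*} [Field F] [LieRing L] [LieAlgebra F L]
    [AddCommGroup V] [Module F V] (hL : IsPerfectLie F L) (hzpd : IsZpdLie F L)
    (f : L →ₗ[F] L →ₗ[F] V) (hf : ∀ x y : L, ⁅x, y⁆ = 0 → f x y = 0) :
    ∃ Ψ : L →ₗ[F] V, ∀ x y : L, f x y = Ψ ⁅x, y⁆ := by
  let b : L ⊗[F] L →ₗ[F] L := TensorProduct.lift (LieModule.toEnd F L L : L →ₗ[F] L →ₗ[F] L)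
  let T : L ⊗[F] L →ₗ[F] V := TensorProduct.lift f
  have hb : ∀ x y : L, b (x ⊗ₜ y) = ⁅x, y⁆ := fun x y => by simp [b]
  have hb_surj : LinearMap.range b = ⊤ := by
    rw [eq_top_iff, ← hL.span_bracket_eq_top, Submodule.span_le]
    rintro _ ⟨x, y, rfl⟩
    exact ⟨x ⊗ₜ y, hb x y⟩
  have hker : ∀ t, b t = 0 → T t = 0 := by
    intro t ht
    -- Linear functionals separate points of `V`, so the scalar zpd property applied to each `ω ∘ f`
    -- suffices to show that `T` vanishes on the kernel of the bracket map `b`.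
    refine (Module.forall_dual_apply_eq_zero_iff F _).1 fun ω => ?_
    obtain ⟨Φ, hΦ⟩ := hzpd (f.compr₂ ω) fun x y hxy => by simp [hf x y hxy]
    let e : L →ₗ[F] (⁅(⊤ : LieIdeal F L), (⊤ : LieIdeal F L)⁆ : LieIdeal F L) :=
      LinearMap.codRestrict (⁅(⊤ : LieIdeal F L), (⊤ : LieIdeal F L)⁆ : LieIdeal F L).toSubmodule
        LinearMap.id fun x => by
          have h : x ∈ (⁅(⊤ : LieIdeal F L), (⊤ : LieIdeal F L)⁆ : LieIdeal F L) := by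
            rw [hL]; exact LieSubmodule.mem_top x
          exact h
    have h : ω ∘ₗ T = Φ ∘ₗ e ∘ₗ b := by
      refine TensorProduct.ext' fun x y => ?_
      have : e (b (x ⊗ₜ y)) = bracketInDerived F x y := Subtype.ext (hb x y)
      simpa [T, this] using hΦ x y
    simpa [ht] using LinearMap.congr_fun h t
  obtain ⟨g, hg⟩ := b.exists_rightInverse_of_surjective hb_surj
  refine ⟨T ∘ₗ g, fun x y => ?_⟩
  have h := hker (x ⊗ₜ y - g ⁅x, y⁆) (by
    rw [map_sub, hb, ← LinearMap.comp_apply, hg, LinearMap.id_apply, sub_self])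
  rw [map_sub, sub_eq_zero] at h
  simpa [T] using h

/-! ### From the Jacobi identity to brackets modulo the center -/

section Commutators

variable {F L A : Type*} [Field F] [LieRing L] [LieAlgebra F L] [Ring A] [Algebra F A]

/-- If `[φ x, φ y]` depends linearly on `[x, y]`, then `[φ [x, y], φ z]` satisfies the Jacobi
identity. -/
theorem commutator_jacobi {φ Ψ : L →ₗ[F] A} (hΨ : ∀ x y, φ x * φ y - φ y * φ x = Ψ ⁅x, y⁆)
    (x y z : L) : (φ ⁅y, z⁆ * φ x - φ x * φ ⁅y, z⁆) + (φ ⁅z, x⁆ * φ y - φ y * φ ⁅z, x⁆) +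
      (φ ⁅x, y⁆ * φ z - φ z * φ ⁅x, y⁆) = 0 := by
  rw [hΨ, hΨ, hΨ, ← map_add, ← map_add]
  have : ⁅⁅y, z⁆, x⁆ + ⁅⁅z, x⁆, y⁆ + ⁅⁅x, y⁆, z⁆ = 0 := by
    rw [← lie_skew ⁅y, z⁆ x, ← lie_skew ⁅z, x⁆ y, ← lie_skew ⁅x, y⁆ z, ← neg_add, ← neg_add,
      lie_jacobi, neg_zero]
  rw [this, map_zero]

open FunctionalIdentity

/-- Makes up for `φ` not being injective. When `φ k = 0`, the Jacobi relation reduces to `[φ ⁅k, y⁆,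
φ z] = [φ ⁅k, z⁆, φ y]`, a two-variable identity whose noncentral part `p` satisfies `p = -p`. So `φ
⁅k, y⁆` is central for chosen preimages `y`; feeding these in as `z` shows that, for arbitrary `y`,
it commutes with the whole range. -/
theorem map_lie_mem_center_of_map_eq_zero {d : ℕ} (hd : 2 ≤ d) {φ Ψ : L →ₗ[F] A}
    (hR : IsDFree d (Set.range φ)) (h2 : ∀ a : A, a + a = 0 → a = 0)
    (hΨ : ∀ x y, φ x * φ y - φ y * φ x = Ψ ⁅x, y⁆) {k : L} (hk : φ k = 0) (y : L) :
    φ ⁅k, y⁆ ∈ Subring.center A := by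
  have hJ : ∀ y z, (φ ⁅k, y⁆ * φ z - φ z * φ ⁅k, y⁆) - (φ ⁅k, z⁆ * φ y - φ y * φ ⁅k, z⁆) = 0 := by
    intro y z
    have h := commutator_jacobi hΨ k y z
    rw [hk, ← lie_skew z k, map_neg] at h
    rw [← h]
    noncomm_ring
  choose s hs using fun r : Set.range φ => r.2
  have hG : ∀ r, φ ⁅k, s r⁆ ∈ Subring.center A := by
    obtain ⟨p, q, c₀, c₁, hc₀, hc₁, hE0, hE1, hF0, hF1⟩ := hR.two_variables hd
      (fun r => -φ ⁅k, s r⁆) (fun r => φ ⁅k, s r⁆) (fun r => φ ⁅k, s r⁆) (fun r => -φ ⁅k, s r⁆)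
      (fun r t => by
        have h := hJ (s r) (s t)
        rw [hs, hs] at h
        rw [← h]
        noncomm_ring)
    have hp := hR.one_variable hd (a := p) (b := p) fun r => by
      have e : p * (r : A) + r * p = -c₀ r - c₁ r := by
        linear_combination (norm := noncomm_ring) hF1 r - hE0 r
      rw [e]
      exact sub_mem (neg_mem (hc₀ _)) (hc₁ _)
    have hp0 : p = 0 := h2 p (eq_neg_iff_add_eq_zero.1 hp.2)
    intro r
    have e := hE0 r
    rw [hp0, mul_zero, zero_add] at e
    rw [← neg_neg (φ ⁅k, s r⁆), e]
    exact neg_mem (hc₀ r)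
  have hcomm : ∀ r : Set.range φ, φ ⁅k, y⁆ * r - r * φ ⁅k, y⁆ = 0 := fun r => by
    have h := hJ y (s r)
    rw [hs, Subring.mem_center_iff.1 (hG r), sub_self, sub_zero] at h
    exact h
  exact hR.mem_center_of_commute hd fun r => by rw [hcomm]; exact zero_mem _

theorem exists_map_lie_sub_mem_center {φ Ψ : L →ₗ[F] A}
    (hR : IsDFree 3 (Set.range φ)) (h2 : ∀ a : A, a + a = 0 → a = 0)
    (hΨ : ∀ x y, φ x * φ y - φ y * φ x = Ψ ⁅x, y⁆) :
    ∃ z ∈ Subring.center A, ∀ x y, φ ⁅x, y⁆ - z * (φ x * φ y - φ y * φ x) ∈ Subring.center A := by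
  -- The element `φ ⁅x, y⁆` need not be a function of `φ x` and `φ y`, so the identity is solved for
  -- chosen preimages. Replacing `x`, `y` by these changes them by elements of the kernel of `φ`,
  -- and hence `φ ⁅x, y⁆` by central elements.
  choose s hs using fun r : Set.range φ => r.2
  obtain ⟨z, hz, hG⟩ := hR.exists_sub_mul_commutator_mem_center le_rfl h2
    (fun r t => φ ⁅s r, s t⁆) (fun r t => by rw [← lie_skew, map_neg])
    (fun r t u => by simpa only [hs] using commutator_jacobi hΨ (s r) (s t) (s u))
  refine ⟨z, hz, fun x y => ?_⟩
  let r : Set.range φ := ⟨φ x, x, rfl⟩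
  let t : Set.range φ := ⟨φ y, y, rfl⟩
  have hx := map_lie_mem_center_of_map_eq_zero (by norm_num) hR h2 hΨ (k := x - s r)
    (by simp [hs, r]) y
  have hy := map_lie_mem_center_of_map_eq_zero (by norm_num) hR h2 hΨ (k := y - s t)
    (by simp [hs, t]) (s r)
  have e : ⁅x, y⁆ = ⁅x - s r, y⁆ - ⁅y - s t, s r⁆ + ⁅s r, s t⁆ := by
    rw [sub_lie, sub_lie, ← lie_skew y (s r), ← lie_skew (s t) (s r)]
    abel
  rw [e, map_add, map_sub, add_sub_assoc]
  exact add_mem (sub_mem hx hy) (hG r t)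

end Commutators

/-! ### Assembling the homomorphism and the central part -/

theorem theorem9p4 {F L A : Type*} [Field F] (hchar : ringChar F ≠ 2)
    [LieRing L] [LieAlgebra F L] (hperf : IsPerfectLie F L) (hzpd : IsZpdLie F L)
    [Ring A] [Algebra F A] (hZ : IsField (Subalgebra.center F A))
    (φ : L →ₗ[F] A) (hφ : PreservesCommutativity φ)
    (hfree : FunctionalIdentity.IsDFree 3 (Set.range φ)) :
    ∃ (α : Subalgebra.center F A) (θ : L →ₗ⁅F⁆ A) (β : L →ₗ[F] Subalgebra.center F A),
      ∀ x : L, φ x = (α : A) * θ x + (β x : A) := by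
  have h2 : ∀ a : A, a + a = 0 → a = 0 := fun a ha => by
    rw [← two_smul F, smul_eq_zero] at ha
    exact ha.resolve_left (Ring.two_ne_zero hchar)
  obtain ⟨Ψ, hΨ⟩ := hzpd.exists_linearMap hperf
    (((LinearMap.mul F A) - (LinearMap.mul F A).flip).compl₁₂ φ φ)
    (fun x y hxy => by simpa [sub_eq_zero] using (hφ x y hxy).eq)
  replace hΨ : ∀ x y, φ x * φ y - φ y * φ x = Ψ ⁅x, y⁆ := fun x y => by simpa using hΨ x y
  obtain ⟨z, hz, hzφ⟩ := exists_map_lie_sub_mem_center hfree h2 hΨ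
  have hz' : ∀ a, a * z = z * a := Subring.mem_center_iff.1 hz
  have hcen : ∀ x, φ x - z * Ψ x ∈ Subalgebra.center F A := by
    let g : L →ₗ[F] A := φ - LinearMap.mulLeft F z ∘ₗ Ψ
    have h : Submodule.span F {z : L | ∃ x y : L, ⁅x, y⁆ = z} ≤
        (Subalgebra.toSubmodule (Subalgebra.center F A)).comap g := by
      rw [Submodule.span_le]
      rintro _ ⟨x, y, rfl⟩
      have h := hzφ x y
      rw [hΨ] at h
      exact (Subalgebra.mem_center_iff (R := F)).2 (Subring.mem_center_iff.1 h)
    rw [hperf.span_bracket_eq_top] at h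
    exact fun x => h (Submodule.mem_top (x := x))
  by_cases hz0 : z = 0
  · refine ⟨0, 0, φ.codRestrict (Subalgebra.toSubmodule (Subalgebra.center F A)) fun x => ?_,
      fun x => ?_⟩
    · simpa [hz0] using hcen x
    · simp only [ZeroMemClass.coe_zero, zero_mul, zero_add]
      rfl
  obtain ⟨⟨w, hw⟩, hzw⟩ := hZ.mul_inv_cancel
    (a := ⟨z, Subalgebra.mem_center_iff.2 hz'⟩) (fun h => hz0 (congrArg Subtype.val h))
  replace hzw : z * w = 1 := congrArg Subtype.val hzw
  have hwz : w * z = 1 := by rw [hz', hzw]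
  -- The factor `z²` is what makes brackets match: `zΨ` and `φ` differ by central elements, so `[z²Ψ
  -- x, z²Ψ y] = z² [φ x, φ y] = z²Ψ ⁅x, y⁆`.
  let θ : L →ₗ⁅F⁆ A :=
    { LinearMap.mulLeft F (z * z) ∘ₗ Ψ with
      map_lie' := fun {x y} => by
        obtain ⟨c, hc, hx⟩ : ∃ c, (∀ a, a * c = c * a) ∧ z * Ψ x = φ x - c :=
          ⟨_, Subalgebra.mem_center_iff.1 (hcen x), by abel⟩
        obtain ⟨e, he, hy⟩ : ∃ c, (∀ a, a * c = c * a) ∧ z * Ψ y = φ y - c :=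
          ⟨_, Subalgebra.mem_center_iff.1 (hcen y), by abel⟩
        have hmul : ∀ u v, z * u * (z * v) = z * z * (u * v) := fun u v => by
          rw [mul_assoc, ← mul_assoc u, hz', mul_assoc, mul_assoc]
        have h : (φ x - c) * (φ y - e) - (φ y - e) * (φ x - c) = φ x * φ y - φ y * φ x := by
          simp only [mul_sub, sub_mul, hc (φ y), he (φ x), hc e]
          abel
        change z * z * Ψ ⁅x, y⁆ = ⁅z * z * Ψ x, z * z * Ψ y⁆
        rw [LieRing.of_associative_ring_bracket, ← hΨ, mul_assoc z z (Ψ x), mul_assoc z z (Ψ y),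
          hx, hy, hmul, hmul, ← mul_sub, h] }
  refine ⟨⟨w, hw⟩, θ, LinearMap.codRestrict (Subalgebra.toSubmodule (Subalgebra.center F A))
    (φ - LinearMap.mulLeft F z ∘ₗ Ψ) hcen, fun x => ?_⟩
  change φ x = w * (z * z * Ψ x) + (φ x - z * Ψ x)
  rw [mul_assoc z, ← mul_assoc w, hwz, one_mul]
  abel
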